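/- **Setting.** Consider the two-stage problem $$(P)\qquad \min_{x\in\mathbb R^{n_x},\,y(\cdot)}\ \max_{z\in U}\ c(z)^\top x+d^\top y(z)\quad\text{s.t.}\quad A(z)x+By(z)\le r(z)\ \ \forall z\in U,$$ where $y(\cdot)$ ranges over all functions $\mathbb R^L\to\mathbb R^{n_y}$, $c,A,r$ are affine in $z$, $d\in\mathbb R^{n_y}$ and $B\in\mathbb R^{m\times n_y}$ are fixed, $U\subset\mathbb R^L$ is convex and compact with nonempty relative interior, and the optimal (worst-case) value is finite. A pair $(x,y(\cdot))$ is ARO if it is feasible and has the smallest worst-case value among feasible pairs. It is PARO if it is ARO and there is no ARO pair $(\bar x,\bar y(\cdot))$ with $c(z)^\top\bar x+d^\top\bar y(z)\le c(z)^\top x+d^\top y(z)$ for all $z\in U$ and strict inequality for some $z\in U$. A here-and-now solution $x$ is PARO if $(x,y(\cdot))$ is PARO for some $y(\cdot)$. For a static problem $\min_{x\in X}\max_{z\in U}f(x,z)$, $x$ is PRO if it is optimal and there is no optimal $\bar x$ with $f(\bar x,z)\le f(x,z)$ for all $z\in U$ and strict inequality for some $z\in U$. **Elimination.** Put $\varphi_i(x,z)=r_i(z)-a_i(z)^\top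 x$ for $i=1,\dots,m$, let $b_0=d$, and let $b_1,\dots,b_m$ be the rows of $B$. Apply Fourier–Motzkin elimination of $y_1,\dots,y_{n_y}$, in this order, to the system $b_i^\top y\le\varphi_i$, $i=0,\dots,m$, where $\varphi_0=t-c(z)^\top x$ and $t$ is an epigraph variable. The bounds on $y_k$ so obtained have the form $\sum_{p}\alpha(S,p)\varphi_p-\sum_{l>k}\beta(S,l)y_l$; let $C_k^-$ and $C_k^+$ be the finite sets of lower and upper bounds. They consist of the original constraints whose first variable is $y_k$, solved for $y_k$, and of the inequalities $S\le T$ solved for $y_k$, where $S\in C_l^-$, $T\in C_l^+$, $l<k$, and $y_k$ is the first variable that does not cancel in $S\le T$. Let $\mathcal P$ be the set of pairs $(S,T)$ with $S\in C_k^-$, $T\in C_k^+$ for some $k$ and $\beta(S,l)=\beta(T,l)$ for all $l>k$, together with, for each $i$ with $b_i=0$, the pair consisting of $S=0$ and $T=\varphi_i$. Let $M$ be the set of pairs in $\mathcal P$ that involve $\varphi_0$ and $N$ the set of those that do not. Define $$\mathcal X_{\rm FME}=\Big\{x:\ \sum_{p}\alpha(S,p)\varphi_p(x,z)\le\sum_{p}\alpha(T,p)\varphi_p(x,z)\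 \ \forall (S,T)\in N,\ z\in U\Big\},$$ $$h_{S,T}(x,z)=\sum_{p\ge1}\frac{\alpha(S,p)}{\alpha(T,0)-\alpha(S,0)}\varphi_p(x,z)-\sum_{p\ge1}\frac{\alpha(T,p)}{\alpha(T,0)-\alpha(S,0)}\varphi_p(x,z)\qquad((S,T)\in M).$$ **Lemma.** The set $M$ is finite and nonempty, and each $h_{S,T}$ is affine in $x$ and affine in $z$, so that $\max_{(S,T)\in M}h_{S,T}$ is convex piecewise linear in $x$. 1. A here-and-now solution $x^*$ is PARO to $(P)$ if and only if it is PRO to $$\min_{x\in\mathcal X_{\rm FME}}\ \max_{z\in U}\ c(z)^\top x+\max_{(S,T)\in M}h_{S,T}(x,z).$$ 2. If $(x^*,y^*(\cdot))$ is ARO, then $d^\top y^*(z)\ge\max_{(S,T)\in M}h_{S,T}(x^*,z)$ for all $z\in U$, with equality in every scenario $z\in U$ that maximizes $c(z)^\top x^*+\max_{(S,T)\in M}h_{S,T}(x^*,z)$ over $U$. 3. If $x^*$ is PARO and $(x^*,y^*(\cdot))$ is ARO, then $d^\top y^*(z)=\max_{(S,T)\in M}h_{S,T}(x^*,z)$ holds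 for all $z\in U$ if and only if the pair $(x^*,y^*(\cdot))$ is PARO. -/

import Mathlib

noncomputable section

/-! ### Two-stage linear robust optimization with fixed recourse -/

/-- Data of the adaptive robust problem
`min_{x, y(·)} max_{z ∈ U} c(z)ᵀ x + dᵀ y(z)` subject to `A(z) x + B y(z) ≤ r(z)` for all `z ∈ U`,
where `c`, `A`, `r` are affine in the uncertain parameter `z ∈ ℝ^L`, and `d`, `B` are fixed. -/
structure AdaptiveProblem (L nx ny m : ℕ) where
  c : (Fin L → ℝ) →ᵃ[ℝ] (Fin nx → ℝ)
  d : Fin ny → ℝ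
  A : (Fin L → ℝ) →ᵃ[ℝ] Matrix (Fin m) (Fin nx) ℝ
  B : Matrix (Fin m) (Fin ny) ℝ
  r : (Fin L → ℝ) →ᵃ[ℝ] (Fin m → ℝ)
  U : Set (Fin L → ℝ)

/-! ### Static robust optimization: `min_{x ∈ X} max_{z ∈ U} f(x, z)` -/

/-- `x` is robustly optimal: feasible, with the smallest worst-case objective value. -/
def IsRobustOptimal {E Z : Type*} (X : Set E) (U : Set Z) (f : E → Z → EReal) (x : E) : Prop :=
  x ∈ X ∧ ∀ x' ∈ X, (⨆ z ∈ U, f x z) ≤ ⨆ z ∈ U, f x' z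

/-- `x` is Pareto robustly optimal (PRO): robustly optimal, and no robustly optimal solution is at
least as good in every scenario and strictly better in some scenario. -/
def IsParetoRobustOptimal {E Z : Type*} (X : Set E) (U : Set Z) (f : E → Z → EReal) (x : E) :
    Prop :=
  IsRobustOptimal X U f x ∧
    ¬ ∃ x', IsRobustOptimal X U f x' ∧ (∀ z ∈ U, f x' z ≤ f x z) ∧ ∃ z ∈ U, f x' z < f x z

namespace AdaptiveProblem

variable {L nx ny m : ℕ} (P : AdaptiveProblem L nx ny m)

/-- Objective value `c(z)ᵀ x + dᵀ y(z)` in scenario `z`. -/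
def objective (x : Fin nx → ℝ) (y : (Fin L → ℝ) → Fin ny → ℝ) (z : Fin L → ℝ) : ℝ :=
  dotProduct (P.c z) x + dotProduct P.d (y z)

/-- Worst-case objective value of a pair (possibly `+∞`, as `y` is an arbitrary function). -/
def worstCase (x : Fin nx → ℝ) (y : (Fin L → ℝ) → Fin ny → ℝ) : EReal :=
  ⨆ z ∈ P.U, (P.objective x y z : EReal)

/-- The pair `(x, y(·))` is adaptive robustly feasible (ARF). -/
def IsARF (x : Fin nx → ℝ) (y : (Fin L → ℝ) → Fin ny → ℝ) : Prop :=
  ∀ z ∈ P.U, (P.A z).mulVec x + P.B.mulVec (y z) ≤ P.r z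

/-- The optimal (worst-case) value of the problem. -/
def optimalValue : EReal :=
  ⨅ (x : Fin nx → ℝ) (y : (Fin L → ℝ) → Fin ny → ℝ) (_ : P.IsARF x y), P.worstCase x y

/-- The pair `(x, y(·))` is adaptive robustly optimal (ARO). -/
def IsARO (x : Fin nx → ℝ) (y : (Fin L → ℝ) → Fin ny → ℝ) : Prop :=
  P.IsARF x y ∧ ∀ x' y', P.IsARF x' y' → P.worstCase x y ≤ P.worstCase x' y'

/-- The pair `(x, y(·))` is Pareto adaptive robustly optimal (PARO). -/
def IsPAROPair (x : Fin nx → ℝ) (y : (Fin L → ℝ) → Fin ny → ℝ) : Prop :=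
  P.IsARO x y ∧
    ¬ ∃ x' y', P.IsARO x' y' ∧ (∀ z ∈ P.U, P.objective x' y' z ≤ P.objective x y z) ∧
      ∃ z ∈ P.U, P.objective x' y' z < P.objective x y z

/-- The here-and-now decision `x` is PARO. -/
def IsPARO (x : Fin nx → ℝ) : Prop :=
  ∃ y, P.IsPAROPair x y

end AdaptiveProblem

/-! ### Fourier–Motzkin elimination

The system is `∑ l, b i l * y l ≤ φ i` for `i : ι`; the variables are eliminated in the order of
their index. -/

/-- A linear lower or upper bound
`∑ p, α p * φ p - ∑ l > k, β l * y l` on a variable `y k`.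
The set of constraints that the bound uses is the support of `α`. -/
@[ext]
structure FMEBound (ι : Type*) (n : ℕ) where
  α : ι → ℝ
  β : Fin n → ℝ

inductive BoundSide
  | lower
  | upper

namespace FMEBound

variable {ι : Type*} {n : ℕ}

/-- The bound on `y k` obtained by dividing constraint `i` by the coefficient `b i k`. -/
def ofConstraint [DecidableEq ι] (b : ι → Fin n → ℝ) (i : ι) (k : Fin n) : FMEBound ι n where
  α := Pi.single i (b i k)⁻¹
  β := fun l => if k < l then b i l / b i k else 0

/-- The bound on `y k` obtained by solving `S ≤ T` for `y k`, where `S` and `T` are a lower and an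
upper bound on the same eliminated variable. -/
def combine (S T : FMEBound ι n) (k : Fin n) : FMEBound ι n where
  α := fun p => (S.α p - T.α p) / (S.β k - T.β k)
  β := fun l => if k < l then (S.β l - T.β l) / (S.β k - T.β k) else 0

end FMEBound

/-- `IsFMEBound b .lower k` is the set `C_k⁻` of lower bounds on `y k`, and `IsFMEBound b .upper k`
the set `C_k⁺` of upper bounds, in the elimination of `y 0, y 1, …`.
A bound on `y k` comes either from an original constraint whose first variable is `y k`, or from a
lower and an upper bound on an earlier variable `y l` in whose comparison `y k` is the first
variable that does not cancel. -/
inductive IsFMEBound {ι : Type*} [DecidableEq ι] {n : ℕ} (b : ι → Fin n → ℝ) :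
    BoundSide → Fin n → FMEBound ι n → Prop
  | ofConstraint_lower (i : ι) (k : Fin n) (h0 : ∀ l < k, b i l = 0) (hk : b i k < 0) :
      IsFMEBound b .lower k (FMEBound.ofConstraint b i k)
  | ofConstraint_upper (i : ι) (k : Fin n) (h0 : ∀ l < k, b i l = 0) (hk : 0 < b i k) :
      IsFMEBound b .upper k (FMEBound.ofConstraint b i k)
  | combine_lower (l k : Fin n) (hlk : l < k) (S T : FMEBound ι n)
      (hS : IsFMEBound b .lower l S) (hT : IsFMEBound b .upper l T)
      (hj : ∀ j, l < j → j < k → S.β j = T.β j) (hk : T.β k < S.β k) :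
      IsFMEBound b .lower k (FMEBound.combine S T k)
  | combine_upper (l k : Fin n) (hlk : l < k) (S T : FMEBound ι n)
      (hS : IsFMEBound b .lower l S) (hT : IsFMEBound b .upper l T)
      (hj : ∀ j, l < j → j < k → S.β j = T.β j) (hk : S.β k < T.β k) :
      IsFMEBound b .upper k (FMEBound.combine S T k)

/-- The pairs `(S, T)` such that `S ≤ T` is a constraint, free of `y`, of the fully eliminated
system. An original constraint `0 ≤ φ i` without variables is kept, in the form
`S = 0`, `T = φ i`. -/
def fmePairs {ι : Type*} [DecidableEq ι] {n : ℕ} (b : ι → Fin n → ℝ) :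
    Set (FMEBound ι n × FMEBound ι n) :=
  {q | (∃ k, IsFMEBound b .lower k q.1 ∧ IsFMEBound b .upper k q.2 ∧
          ∀ l, k < l → q.1.β l = q.2.β l) ∨
       ∃ i, b i = 0 ∧ q = (⟨0, 0⟩, ⟨Pi.single i 1, 0⟩)}

namespace AdaptiveProblem

variable {L nx ny m : ℕ} (P : AdaptiveProblem L nx ny m)

/-- Coefficients of `y` in the epigraph form: row `0` is `dᵀ y ≤ t - c(z)ᵀ x`, and row `i + 1` is
`(B y) i ≤ r(z) i - (A(z) x) i`. -/
def epiRows : Fin (m + 1) → Fin ny → ℝ :=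
  Fin.cons P.d P.B

/-- `φ_i(x, z) = r_i(z) - a_i(z)ᵀ x`. -/
def phi (x : Fin nx → ℝ) (z : Fin L → ℝ) (i : Fin m) : ℝ :=
  P.r z i - (P.A z).mulVec x i

/-- The eliminated constraints that involve row `0`. -/
def setM : Set (FMEBound (Fin (m + 1)) ny × FMEBound (Fin (m + 1)) ny) :=
  {q ∈ fmePairs P.epiRows | q.1.α 0 ≠ 0 ∨ q.2.α 0 ≠ 0}

/-- The eliminated constraints that do not involve row `0`. -/
def setN : Set (FMEBound (Fin (m + 1)) ny × FMEBound (Fin (m + 1)) ny) :=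
  {q ∈ fmePairs P.epiRows | q.1.α 0 = 0 ∧ q.2.α 0 = 0}

/-- The feasible set after elimination of all adaptive variables. -/
def XFME : Set (Fin nx → ℝ) :=
  {x | ∀ q ∈ P.setN, ∀ z ∈ P.U,
    ∑ p : Fin m, q.1.α p.succ * P.phi x z p ≤ ∑ p : Fin m, q.2.α p.succ * P.phi x z p}

/-- The function `h_{S,T}(x, z)`. -/
def hST (q : FMEBound (Fin (m + 1)) ny × FMEBound (Fin (m + 1)) ny)
    (x : Fin nx → ℝ) (z : Fin L → ℝ) : ℝ :=
  ∑ p : Fin m, q.1.α p.succ / (q.2.α 0 - q.1.α 0) * P.phi x z p -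
    ∑ p : Fin m, q.2.α p.succ / (q.2.α 0 - q.1.α 0) * P.phi x z p

/-- The objective `c(z)ᵀ x + max_{(S,T) ∈ M} h_{S,T}(x, z)` of the static problem. -/
def fmeObjective (x : Fin nx → ℝ) (z : Fin L → ℝ) : EReal :=
  (dotProduct (P.c z) x : ℝ) + ⨆ q ∈ P.setM, (P.hST q x z : EReal)

end AdaptiveProblem

end

/-!
For a fixed decision `x` and scenario `z`, Fourier–Motzkin elimination says that a recourse `y` with
`B y ≤ φ(x, z)` and `dᵀ y ≤ s` exists if and only if the eliminated inequalities hold with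
`φ₀ = s`. Lower bounds only have nonpositive coefficients `α`, upper bounds only nonnegative ones,
so `α(T, 0) - α(S, 0) > 0` for every pair in `M`, and the eliminated inequality of such a pair reads
`h_{S,T}(x, z) ≤ s`; the pairs in `N` do not see `s` (`exists_recourse_iff`). The set `M` is finite
because there are finitely many bounds on each variable, and nonempty because otherwise `s` could be
sent to `-∞` and the optimal value would be `-∞`.

Hence the cheapest feasible recourse in scenario `z` costs exactly `max_M h_{S,T}(x, z)`, and the
scenario-wise cheapest recourses form a decision rule, since decision rules are arbitrary functions
(`exists_greedy`). The objective of an arbitrary feasible pair dominates `fmeObjective`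
(`fmeObjective_le_objective`), with equality for this greedy rule. So both the worst-case order and
the Pareto order on pairs restrict, along `x ↦ (x, greedy rule)`, to the orders of the static
problem, which yields all the claims.
-/

/-! ### Fourier–Motzkin elimination -/

/-- A point fits between two finite sets of reals, either of which may be empty. -/
lemma exists_between_finite_sets {s t : Set ℝ} (hs : s.Finite) (ht : t.Finite)
    (h : ∀ a ∈ s, ∀ b ∈ t, a ≤ b) : ∃ c, (∀ a ∈ s, a ≤ c) ∧ ∀ b ∈ t, c ≤ b := by
  rcases s.eq_empty_or_nonempty with rfl | hs'
  · obtain ⟨c, hc⟩ := ht.bddBelow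
    exact ⟨c, by simp, fun b hb => hc hb⟩
  rcases t.eq_empty_or_nonempty with rfl | ht'
  · obtain ⟨c, hc⟩ := hs.bddAbove
    exact ⟨c, fun a ha => hc ha, by simp⟩
  obtain ⟨c, hc⟩ := exists_between_of_forall_le hs' ht' h
  exact ⟨c, fun a ha => hc.1 ha, fun b hb => hc.2 hb⟩

namespace FMEBound

variable {ι : Type*} {n : ℕ}

/-- The value of a bound at right-hand side `φ` and variables `y`. The coefficients `β` of a bound
on `y k` produced by the elimination vanish up to index `k`, so the second sum may run over all
variables. -/
def eval [Fintype ι] (S : FMEBound ι n) (φ : ι → ℝ) (y : Fin n → ℝ) : ℝ :=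
  dotProduct S.α φ - dotProduct S.β y

lemma mul_sub_eval_ofConstraint [Fintype ι] [DecidableEq ι] (b : ι → Fin n → ℝ) (i : ι)
    (k : Fin n) (h0 : ∀ l < k, b i l = 0) (hk : b i k ≠ 0) (φ : ι → ℝ) (y : Fin n → ℝ) :
    b i k * (y k - (ofConstraint b i k).eval φ y) = dotProduct (b i) y - φ i := by
  have hβ : (ofConstraint b i k).β = (b i k)⁻¹ • b i - Pi.single k 1 := by
    ext l
    rcases lt_trichotomy l k with h | rfl | h
    · simp [ofConstraint, h.not_gt, h.ne, h0 l h]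
    · simp [ofConstraint, hk]
    · simp [ofConstraint, h, h.ne', div_eq_inv_mul]
  have hα : dotProduct (ofConstraint b i k).α φ = (b i k)⁻¹ * φ i := by
    simp [ofConstraint, single_dotProduct]
  rw [eval, hβ, hα, sub_dotProduct, smul_dotProduct, single_dotProduct, smul_eq_mul]
  field_simp
  ring

lemma mul_sub_eval_combine [Fintype ι] (S T : FMEBound ι n) (k : Fin n)
    (h0 : ∀ j < k, S.β j = T.β j) (hk : S.β k - T.β k ≠ 0) (φ : ι → ℝ) (y : Fin n → ℝ) :
    (S.β k - T.β k) * (y k - (combine S T k).eval φ y) = T.eval φ y - S.eval φ y := by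
  have hβ : (combine S T k).β = (S.β k - T.β k)⁻¹ • (S.β - T.β) - Pi.single k 1 := by
    ext l
    rcases lt_trichotomy l k with h | rfl | h
    · simp [combine, h.not_gt, h.ne, h0 l h]
    · simp [combine, hk]
    · simp [combine, h, h.ne', div_eq_inv_mul]
  have hα : (combine S T k).α = (S.β k - T.β k)⁻¹ • (S.α - T.α) := by
    ext p
    simp [combine, div_eq_inv_mul]
  simp only [eval, hβ, hα, sub_dotProduct, smul_dotProduct, single_dotProduct, smul_eq_mul]
  field_simp
  ring

end FMEBound

namespace IsFMEBound

variable {ι : Type*} [DecidableEq ι] {n : ℕ} {b : ι → Fin n → ℝ}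

lemma beta_eq_zero {s : BoundSide} {k : Fin n} {S : FMEBound ι n} (h : IsFMEBound b s k S)
    {j : Fin n} (hj : j ≤ k) : S.β j = 0 := by
  cases h <;> simp [FMEBound.ofConstraint, FMEBound.combine, hj.not_gt]

/-- If a lower bound `S` and an upper bound `T` on `y l` agree strictly between `l` and `k`, then
they agree everywhere before `k`. -/
lemma beta_eq_beta {l k : Fin n} {S T : FMEBound ι n} (hS : IsFMEBound b .lower l S)
    (hT : IsFMEBound b .upper l T) (hj : ∀ j, l < j → j < k → S.β j = T.β j) :
    ∀ j < k, S.β j = T.β j := fun j hjk => by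
  rcases le_or_gt j l with h | h
  · rw [hS.beta_eq_zero h, hT.beta_eq_zero h]
  · exact hj j h hjk

/-- Each inequality of the elimination is a nonnegative combination of the original constraints:
the coefficients `α` of lower bounds are nonpositive and those of upper bounds nonnegative. -/
lemma alpha_sign {s : BoundSide} {k : Fin n} {S : FMEBound ι n} (h : IsFMEBound b s k S) (p : ι) :
    match s with
    | .lower => S.α p ≤ 0
    | .upper => 0 ≤ S.α p := by
  induction h with
  | ofConstraint_lower i k h0 hk =>
    by_cases hp : p = i
    · subst hp; simpa [FMEBound.ofConstraint] using hk.le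
    · simp [FMEBound.ofConstraint, hp]
  | ofConstraint_upper i k h0 hk =>
    by_cases hp : p = i
    · subst hp; simpa [FMEBound.ofConstraint] using hk.le
    · simp [FMEBound.ofConstraint, hp]
  | combine_lower l k hlk S T hS hT hj hk ihS ihT =>
    exact div_nonpos_of_nonpos_of_nonneg (by dsimp only at ihS ihT; linarith) (by linarith)
  | combine_upper l k hlk S T hS hT hj hk ihS ihT =>
    exact div_nonneg_of_nonpos (by dsimp only at ihS ihT; linarith) (by linarith)

lemma alpha_nonpos {k : Fin n} {S : FMEBound ι n} (h : IsFMEBound b .lower k S) (p : ι) :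
    S.α p ≤ 0 := h.alpha_sign p

lemma alpha_nonneg {k : Fin n} {S : FMEBound ι n} (h : IsFMEBound b .upper k S) (p : ι) :
    0 ≤ S.α p := h.alpha_sign p

/-- Every bound of the elimination is valid at each solution of the original system. -/
lemma valid [Fintype ι] {φ : ι → ℝ} {y : Fin n → ℝ} (hy : ∀ i, dotProduct (b i) y ≤ φ i)
    {s : BoundSide} {k : Fin n} {S : FMEBound ι n} (h : IsFMEBound b s k S) :
    match s with
    | .lower => S.eval φ y ≤ y k
    | .upper => y k ≤ S.eval φ y := by
  induction h with
  | ofConstraint_lower i k h0 hk =>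
    have := FMEBound.mul_sub_eval_ofConstraint b i k h0 hk.ne φ y
    have := hy i
    dsimp only
    nlinarith
  | ofConstraint_upper i k h0 hk =>
    have := FMEBound.mul_sub_eval_ofConstraint b i k h0 hk.ne' φ y
    have := hy i
    dsimp only
    nlinarith
  | combine_lower l k hlk S T hS hT hj hk ihS ihT =>
    have := FMEBound.mul_sub_eval_combine S T k (beta_eq_beta hS hT hj) (by linarith) φ y
    dsimp only at ihS ihT ⊢
    nlinarith
  | combine_upper l k hlk S T hS hT hj hk ihS ihT =>
    have := FMEBound.mul_sub_eval_combine S T k (beta_eq_beta hS hT hj) (by linarith) φ y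
    dsimp only at ihS ihT ⊢
    nlinarith

lemma eval_le [Fintype ι] {φ : ι → ℝ} {y : Fin n → ℝ} (hy : ∀ i, dotProduct (b i) y ≤ φ i)
    {k : Fin n} {S : FMEBound ι n} (h : IsFMEBound b .lower k S) : S.eval φ y ≤ y k :=
  valid hy h

lemma le_eval [Fintype ι] {φ : ι → ℝ} {y : Fin n → ℝ} (hy : ∀ i, dotProduct (b i) y ≤ φ i)
    {k : Fin n} {S : FMEBound ι n} (h : IsFMEBound b .upper k S) : y k ≤ S.eval φ y :=
  valid hy h

lemma setOf_finite [Finite ι] (b : ι → Fin n → ℝ) (k : Fin n) :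
    ∀ s, {S | IsFMEBound b s k S}.Finite := by
  induction k using WellFoundedLT.induction with
  | ind k ih =>
  intro s
  have h1 : (Set.range fun i => FMEBound.ofConstraint b i k).Finite := Set.finite_range _
  have h2 : (⋃ l ∈ Set.Iio k, Set.image2 (fun S T => FMEBound.combine S T k)
      {S | IsFMEBound b .lower l S} {T | IsFMEBound b .upper l T}).Finite :=
    (Set.toFinite _).biUnion fun l hl => (ih l hl .lower).image2 _ (ih l hl .upper)
  refine (h1.union h2).subset fun S hS => ?_
  cases hS with
  | ofConstraint_lower i _ h0 hk => exact .inl ⟨i, rfl⟩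
  | ofConstraint_upper i _ h0 hk => exact .inl ⟨i, rfl⟩
  | combine_lower l _ hlk S T hS hT hj hk =>
    exact .inr (Set.mem_biUnion (Set.mem_Iio.2 hlk) ⟨S, hS, T, hT, rfl⟩)
  | combine_upper l _ hlk S T hS hT hj hk =>
    exact .inr (Set.mem_biUnion (Set.mem_Iio.2 hlk) ⟨S, hS, T, hT, rfl⟩)

/-- Changing a variable that has already been eliminated does not affect a bound. -/
lemma eval_update [Fintype ι] {s : BoundSide} {k j : Fin n} {S : FMEBound ι n}
    (h : IsFMEBound b s k S) (hj : j ≤ k) (φ : ι → ℝ) (y : Fin n → ℝ) (c : ℝ) :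
    S.eval φ (Function.update y j c) = S.eval φ y := by
  unfold FMEBound.eval dotProduct
  congr 1
  refine Finset.sum_congr rfl fun l _ => ?_
  by_cases hl : l = j
  · subst hl; simp [h.beta_eq_zero hj]
  · simp [hl]

/-- If the bounds on all variables after `y k` are met, then the lower bounds on `y k` lie below
the upper ones: either `S ≤ T` is a constraint of the eliminated system, or it is a bound on the
first later variable that does not cancel. -/
lemma eval_le_eval [Fintype ι] {φ : ι → ℝ}
    (hφ : ∀ q ∈ fmePairs b, dotProduct q.1.α φ ≤ dotProduct q.2.α φ) {y : Fin n → ℝ} {k : Fin n}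
    (hlow : ∀ l, k < l → ∀ S, IsFMEBound b .lower l S → S.eval φ y ≤ y l)
    (hupp : ∀ l, k < l → ∀ S, IsFMEBound b .upper l S → y l ≤ S.eval φ y)
    {S T : FMEBound ι n} (hS : IsFMEBound b .lower k S) (hT : IsFMEBound b .upper k T) :
    S.eval φ y ≤ T.eval φ y := by
  by_cases hall : ∀ l, k < l → S.β l = T.β l
  · have hβ : S.β = T.β := by
      ext j
      rcases le_or_gt j k with h | h
      · rw [hS.beta_eq_zero h, hT.beta_eq_zero h]
      · exact hall j h
    have := hφ (S, T) (.inl ⟨k, hS, hT, hall⟩)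
    dsimp only at this
    rw [FMEBound.eval, FMEBound.eval, hβ]
    linarith
  · push Not at hall
    obtain ⟨j, ⟨hkj, hne⟩, hmin⟩ := WellFounded.has_min (wellFounded_lt (α := Fin n))
      {l | k < l ∧ S.β l ≠ T.β l} hall
    have hj : ∀ i, k < i → i < j → S.β i = T.β i := fun i hi hij => by
      by_contra hc
      exact hmin i ⟨hi, hc⟩ hij
    have key := FMEBound.mul_sub_eval_combine S T j (beta_eq_beta hS hT hj) (sub_ne_zero.2 hne) φ y
    rcases lt_or_gt_of_ne hne with h | h
    · have := hupp j hkj _ (.combine_upper k j hkj S T hS hT hj h)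
      nlinarith
    · have := hlow j hkj _ (.combine_lower k j hkj S T hS hT hj h)
      nlinarith

/-- Back substitution: if the eliminated system holds, the last `j` variables can be chosen within
all their bounds. -/
lemma exists_backSubstitution [Fintype ι] {φ : ι → ℝ}
    (hφ : ∀ q ∈ fmePairs b, dotProduct q.1.α φ ≤ dotProduct q.2.α φ) (j : ℕ) :
    ∃ y : Fin n → ℝ, ∀ k : Fin n, n ≤ k + j →
      (∀ S, IsFMEBound b .lower k S → S.eval φ y ≤ y k) ∧
      (∀ S, IsFMEBound b .upper k S → y k ≤ S.eval φ y) := by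
  induction j with
  | zero => exact ⟨0, fun k hk => absurd k.2 (by omega)⟩
  | succ j ih =>
    obtain ⟨y, hy⟩ := ih
    by_cases hjn : j < n
    swap
    · exact ⟨y, fun k _ => hy k (by omega)⟩
    obtain ⟨k, hk⟩ : ∃ k : Fin n, n = k + j + 1 := ⟨⟨n - (j + 1), by omega⟩, by simp; omega⟩
    have hlater : ∀ l : Fin n, k < l → n ≤ l + j := fun l hl => by
      have : (k : ℕ) < l := hl
      omega
    obtain ⟨c, hc1, hc2⟩ := exists_between_finite_sets
      ((setOf_finite b k .lower).image fun S => S.eval φ y)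
      ((setOf_finite b k .upper).image fun S => S.eval φ y) (by
        rintro _ ⟨S, hS, rfl⟩ _ ⟨T, hT, rfl⟩
        exact eval_le_eval hφ (fun l hl => (hy l (hlater l hl)).1)
          (fun l hl => (hy l (hlater l hl)).2) hS hT)
    refine ⟨Function.update y k c, fun l hl => ?_⟩
    have hkl : k ≤ l := Fin.le_def.2 (by omega)
    rcases hkl.eq_or_lt with rfl | hlt
    · refine ⟨fun S hS => ?_, fun S hS => ?_⟩ <;>
        rw [hS.eval_update le_rfl, Function.update_self]
      · exact hc1 _ ⟨S, hS, rfl⟩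
      · exact hc2 _ ⟨S, hS, rfl⟩
    · refine ⟨fun S hS => ?_, fun S hS => ?_⟩ <;>
        rw [hS.eval_update hkl, Function.update_of_ne hlt.ne']
      · exact (hy l (hlater l hlt)).1 S hS
      · exact (hy l (hlater l hlt)).2 S hS

end IsFMEBound

section fmePairs

variable {ι : Type*} [DecidableEq ι] {n : ℕ}

lemma fmePairs_finite [Finite ι] (b : ι → Fin n → ℝ) : (fmePairs b).Finite := by
  have h1 : (⋃ k, {S | IsFMEBound b .lower k S} ×ˢ {T | IsFMEBound b .upper k T}).Finite :=
    Set.finite_iUnion fun k =>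
      (IsFMEBound.setOf_finite b k .lower).prod (IsFMEBound.setOf_finite b k .upper)
  have h2 : (Set.range fun i : ι =>
      ((⟨0, 0⟩, ⟨Pi.single i 1, 0⟩) : FMEBound ι n × FMEBound ι n)).Finite := Set.finite_range _
  refine (h1.union h2).subset ?_
  rintro q (⟨k, hS, hT, -⟩ | ⟨i, -, rfl⟩)
  · exact .inl (Set.mem_iUnion.2 ⟨k, hS, hT⟩)
  · exact .inr ⟨i, rfl⟩

lemma fmePairs_alpha_nonpos {b : ι → Fin n → ℝ} {q : FMEBound ι n × FMEBound ι n}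
    (hq : q ∈ fmePairs b) (p : ι) : q.1.α p ≤ 0 := by
  rcases hq with ⟨k, hS, -, -⟩ | ⟨i, -, rfl⟩
  · exact hS.alpha_nonpos p
  · simp

lemma fmePairs_alpha_nonneg {b : ι → Fin n → ℝ} {q : FMEBound ι n × FMEBound ι n}
    (hq : q ∈ fmePairs b) (p : ι) : 0 ≤ q.2.α p := by
  rcases hq with ⟨k, -, hT, -⟩ | ⟨i, -, rfl⟩
  · exact hT.alpha_nonneg p
  · by_cases hp : p = i
    · subst hp; simp
    · simp [hp]

/-- Fourier–Motzkin elimination is correct: the system is solvable if and only if the fully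
eliminated system holds. -/
theorem exists_forall_dotProduct_le_iff [Fintype ι] (b : ι → Fin n → ℝ) (φ : ι → ℝ) :
    (∃ y, ∀ i, dotProduct (b i) y ≤ φ i) ↔
      ∀ q ∈ fmePairs b, dotProduct q.1.α φ ≤ dotProduct q.2.α φ := by
  constructor
  · rintro ⟨y, hy⟩ q (⟨k, hS, hT, hβ⟩ | ⟨i, hi, rfl⟩)
    · have hβ' : q.1.β = q.2.β := by
        ext j
        rcases le_or_gt j k with h | h
        · rw [hS.beta_eq_zero h, hT.beta_eq_zero h]
        · exact hβ j h
      have h := (hS.eval_le hy).trans (hT.le_eval hy)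
      rw [FMEBound.eval, FMEBound.eval, hβ'] at h
      linarith
    · have := hy i
      simpa [hi] using this
  · intro hφ
    obtain ⟨y, hy⟩ := IsFMEBound.exists_backSubstitution hφ n
    refine ⟨y, fun i => ?_⟩
    by_cases hi : b i = 0
    · have := hφ _ (.inr ⟨i, hi, rfl⟩)
      simpa [hi] using this
    -- constraint `i` is itself a bound on its first variable `y k`
    · obtain ⟨k, hk, hmin⟩ := WellFounded.has_min (wellFounded_lt (α := Fin n))
        {l | b i l ≠ 0} (Function.ne_iff.1 hi)
      have h0 : ∀ l < k, b i l = 0 := fun l hl => by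
        by_contra hc
        exact hmin l hc hl
      have key := FMEBound.mul_sub_eval_ofConstraint b i k h0 hk φ y
      rcases lt_or_gt_of_ne hk with h | h
      · have := (hy k (by omega)).1 _ (.ofConstraint_lower i k h0 h)
        nlinarith
      · have := (hy k (by omega)).2 _ (.ofConstraint_upper i k h0 h)
        nlinarith

end fmePairs

/-! ### The cheapest recourse -/

namespace AdaptiveProblem

variable {L nx ny m : ℕ} (P : AdaptiveProblem L nx ny m)

lemma setM_finite : P.setM.Finite :=
  (fmePairs_finite P.epiRows).subset fun _ hq => hq.1

lemma alpha_sub_alpha_pos {q : FMEBound (Fin (m + 1)) ny × FMEBound (Fin (m + 1)) ny}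
    (hq : q ∈ P.setM) : 0 < q.2.α 0 - q.1.α 0 := by
  have h1 := fmePairs_alpha_nonpos hq.1 0
  have h2 := fmePairs_alpha_nonneg hq.1 0
  rcases hq.2 with h | h
  · have := lt_of_le_of_ne h1 h
    linarith
  · have := lt_of_le_of_ne h2 (Ne.symm h)
    linarith

lemma hST_eq_div (q : FMEBound (Fin (m + 1)) ny × FMEBound (Fin (m + 1)) ny) (x : Fin nx → ℝ)
    (z : Fin L → ℝ) :
    P.hST q x z = (∑ p : Fin m, q.1.α p.succ * P.phi x z p -
      ∑ p : Fin m, q.2.α p.succ * P.phi x z p) / (q.2.α 0 - q.1.α 0) := by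
  simp only [hST, sub_div, Finset.sum_div, div_mul_eq_mul_div]

/-- A recourse of cost at most `s` exists if and only if the constraints in `N` hold and `s` is at
least every `h_{S,T}`. -/
lemma exists_recourse_iff (x : Fin nx → ℝ) (z : Fin L → ℝ) (s : ℝ) :
    (∃ y : Fin ny → ℝ, dotProduct P.d y ≤ s ∧ (P.A z).mulVec x + P.B.mulVec y ≤ P.r z) ↔
      (∀ q ∈ P.setN,
        ∑ p : Fin m, q.1.α p.succ * P.phi x z p ≤ ∑ p : Fin m, q.2.α p.succ * P.phi x z p) ∧
      ∀ q ∈ P.setM, P.hST q x z ≤ s := by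
  have hsys : (∃ y : Fin ny → ℝ, dotProduct P.d y ≤ s ∧
      (P.A z).mulVec x + P.B.mulVec y ≤ P.r z) ↔
      ∃ y, ∀ i, dotProduct (P.epiRows i) y ≤ (Fin.cons s (P.phi x z) : Fin (m + 1) → ℝ) i := by
    refine exists_congr fun y => ?_
    rw [Fin.forall_fin_succ]
    refine and_congr Iff.rfl (forall_congr' fun i => ?_)
    change dotProduct (P.A z i) x + dotProduct (P.B i) y ≤ P.r z i ↔ dotProduct (P.B i) y ≤ P.r z i - dotProduct (P.A z i) x
    rw [le_sub_iff_add_le']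
  rw [hsys, exists_forall_dotProduct_le_iff]
  simp only [dotProduct, Fin.sum_univ_succ, Fin.cons_zero, Fin.cons_succ]
  -- isolating `s` divides by `α(T, 0) - α(S, 0)`, whose sign keeps the direction of the inequality
  have hM : ∀ q ∈ P.setM, (q.1.α 0 * s + ∑ p : Fin m, q.1.α p.succ * P.phi x z p ≤
      q.2.α 0 * s + ∑ p : Fin m, q.2.α p.succ * P.phi x z p ↔ P.hST q x z ≤ s) := fun q hq => by
    rw [hST_eq_div, div_le_iff₀ (P.alpha_sub_alpha_pos hq)]
    constructor <;> intro h <;> linarith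
  constructor
  · refine fun h => ⟨fun q hq => ?_, fun q hq => (hM q hq).1 (h q hq.1)⟩
    simpa [hq.2.1, hq.2.2] using h q hq.1
  · rintro ⟨h1, h2⟩ q hq
    by_cases h0 : q.1.α 0 = 0 ∧ q.2.α 0 = 0
    · simpa [h0.1, h0.2] using h1 q ⟨hq, h0⟩
    · have hqM : q ∈ P.setM := ⟨hq, by tauto⟩
      exact (hM q hqM).2 (h2 q hqM)

variable {P} {x : Fin nx → ℝ} {y : (Fin L → ℝ) → Fin ny → ℝ} {z : Fin L → ℝ}

lemma IsARF.mem_XFME (h : P.IsARF x y) : x ∈ P.XFME := fun q hq z hz =>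
  ((P.exists_recourse_iff x z _).1 ⟨y z, le_rfl, h z hz⟩).1 q hq

lemma IsARF.hST_le (h : P.IsARF x y) (hz : z ∈ P.U) :
    ∀ q ∈ P.setM, P.hST q x z ≤ dotProduct P.d (y z) :=
  ((P.exists_recourse_iff x z _).1 ⟨y z, le_rfl, h z hz⟩).2

/-- Decision rules are arbitrary functions, so recourses may be chosen scenario by scenario. -/
lemma exists_isARF_of_forall_hST_le (hx : x ∈ P.XFME) (s : (Fin L → ℝ) → ℝ)
    (hs : ∀ z ∈ P.U, ∀ q ∈ P.setM, P.hST q x z ≤ s z) :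
    ∃ y, P.IsARF x y ∧ ∀ z ∈ P.U, dotProduct P.d (y z) ≤ s z := by
  have h : ∀ z, ∃ y : Fin ny → ℝ, z ∈ P.U →
      dotProduct P.d y ≤ s z ∧ (P.A z).mulVec x + P.B.mulVec y ≤ P.r z := fun z => by
    by_cases hz : z ∈ P.U
    · obtain ⟨y, hy⟩ := (P.exists_recourse_iff x z (s z)).2 ⟨fun q hq => hx q hq z hz, hs z hz⟩
      exact ⟨y, fun _ => hy⟩
    · exact ⟨0, fun h => absurd h hz⟩
  choose y hy using h
  exact ⟨y, fun z hz => (hy z hz).2, fun z hz => (hy z hz).1⟩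

lemma exists_isGreatest_hST (hM : P.setM.Nonempty) (x : Fin nx → ℝ) (z : Fin L → ℝ) :
    ∃ v, IsGreatest ((fun q => P.hST q x z) '' P.setM) v := by
  obtain ⟨q, hq, hmax⟩ := Set.exists_max_image P.setM (fun q => P.hST q x z) P.setM_finite hM
  exact ⟨_, ⟨q, hq, rfl⟩, Set.forall_mem_image.2 hmax⟩

lemma fmeObjective_eq {v : ℝ} (hv : IsGreatest ((fun q => P.hST q x z) '' P.setM) v) :
    P.fmeObjective x z = ((dotProduct (P.c z) x + v : ℝ) : EReal) := by
  have : ⨆ q ∈ P.setM, (P.hST q x z : EReal) = v := by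
    refine le_antisymm (iSup₂_le fun q hq => EReal.coe_le_coe_iff.2 (hv.2 ⟨q, hq, rfl⟩)) ?_
    obtain ⟨q, hq, rfl⟩ := hv.1
    exact le_iSup₂ (f := fun q _ => (P.hST q x z : EReal)) q hq
  rw [fmeObjective, this, EReal.coe_add]

lemma fmeObjective_le_objective (hM : P.setM.Nonempty) (h : P.IsARF x y) (hz : z ∈ P.U) :
    P.fmeObjective x z ≤ P.objective x y z := by
  obtain ⟨v, hv⟩ := exists_isGreatest_hST hM x z
  rw [fmeObjective_eq hv, objective, EReal.coe_le_coe_iff]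
  obtain ⟨q, hq, rfl⟩ := hv.1
  have := h.hST_le hz q hq
  dsimp only
  linarith

/-- The recourse is greedy in scenario `z` if and only if its cost is the static objective. -/
lemma objective_eq_fmeObjective_iff (hM : P.setM.Nonempty) :
    (P.objective x y z : EReal) = P.fmeObjective x z ↔
      IsGreatest ((fun q => P.hST q x z) '' P.setM) (dotProduct P.d (y z)) := by
  constructor
  · intro h
    obtain ⟨v, hv⟩ := exists_isGreatest_hST hM x z
    rw [fmeObjective_eq hv, EReal.coe_eq_coe_iff, objective] at h
    rwa [add_left_cancel h]
  · intro h
    rw [fmeObjective_eq h, objective]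

/-- Every decision that is feasible for the static problem has a feasible decision rule whose cost
is the static objective in all scenarios. -/
lemma exists_greedy (hM : P.setM.Nonempty) (hx : x ∈ P.XFME) :
    ∃ y, P.IsARF x y ∧ ∀ z ∈ P.U, (P.objective x y z : EReal) = P.fmeObjective x z := by
  choose v hv using exists_isGreatest_hST hM x
  obtain ⟨y, hy, hyv⟩ := exists_isARF_of_forall_hST_le hx v
    fun z _ q hq => (hv z).2 ⟨q, hq, rfl⟩
  refine ⟨y, hy, fun z hz => le_antisymm ?_ (fmeObjective_le_objective hM hy hz)⟩
  rw [fmeObjective_eq (hv z), EReal.coe_le_coe_iff, objective]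
  linarith [hyv z hz]

/-- Without constraints in `M`, the cost of a feasible decision could be made arbitrarily small. -/
lemma setM_nonempty (hfin : ∃ v : ℝ, P.optimalValue = (v : EReal)) : P.setM.Nonempty := by
  by_contra hM
  rw [Set.not_nonempty_iff_eq_empty] at hM
  obtain ⟨v, hv⟩ := hfin
  obtain ⟨x, y, hxy⟩ : ∃ x y, P.IsARF x y := by
    by_contra! hc
    simp [optimalValue, hc] at hv
  obtain ⟨y', hy', hyv⟩ := exists_isARF_of_forall_hST_le hxy.mem_XFME
    (fun z => v - 1 - dotProduct (P.c z) x) (by simp [hM])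
  have h1 : P.optimalValue ≤ P.worstCase x y' :=
    iInf_le_of_le x (iInf_le_of_le y' (iInf_le_of_le hy' le_rfl))
  have h2 : P.worstCase x y' ≤ ((v - 1 : ℝ) : EReal) := iSup₂_le fun z hz => by
    rw [EReal.coe_le_coe_iff, objective]
    linarith [hyv z hz]
  have := h1.trans h2
  rw [hv, EReal.coe_le_coe_iff] at this
  linarith

/-! ### Comparison of the adaptive and the static problem -/

lemma iSup_fmeObjective_le_worstCase (hM : P.setM.Nonempty) (h : P.IsARF x y) :
    ⨆ z ∈ P.U, P.fmeObjective x z ≤ P.worstCase x y :=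
  iSup₂_mono fun _ hz => fmeObjective_le_objective hM h hz

lemma worstCase_eq_of_greedy
    (h : ∀ z ∈ P.U, (P.objective x y z : EReal) = P.fmeObjective x z) :
    P.worstCase x y = ⨆ z ∈ P.U, P.fmeObjective x z :=
  iSup_congr fun z => iSup_congr (h z)

lemma IsARO.worstCase_eq (hM : P.setM.Nonempty) (h : P.IsARO x y) :
    P.worstCase x y = ⨆ z ∈ P.U, P.fmeObjective x z := by
  obtain ⟨y', hy', hg⟩ := exists_greedy hM h.1.mem_XFME
  refine le_antisymm ?_ (iSup_fmeObjective_le_worstCase hM h.1)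
  rw [← worstCase_eq_of_greedy hg]
  exact h.2 x y' hy'

lemma IsARO.isRobustOptimal (hM : P.setM.Nonempty) (h : P.IsARO x y) :
    IsRobustOptimal P.XFME P.U P.fmeObjective x := by
  refine ⟨h.1.mem_XFME, fun x' hx' => ?_⟩
  obtain ⟨y', hy', hg⟩ := exists_greedy hM hx'
  rw [← h.worstCase_eq hM, ← worstCase_eq_of_greedy hg]
  exact h.2 x' y' hy'

lemma isARO_of_greedy (hM : P.setM.Nonempty)
    (hx : IsRobustOptimal P.XFME P.U P.fmeObjective x) (hy : P.IsARF x y)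
    (hg : ∀ z ∈ P.U, (P.objective x y z : EReal) = P.fmeObjective x z) : P.IsARO x y := by
  refine ⟨hy, fun x' y' h' => ?_⟩
  rw [worstCase_eq_of_greedy hg]
  exact (hx.2 x' h'.mem_XFME).trans (iSup_fmeObjective_le_worstCase hM h')

lemma isPAROPair_of_greedy (hM : P.setM.Nonempty)
    (hx : IsParetoRobustOptimal P.XFME P.U P.fmeObjective x) (hy : P.IsARF x y)
    (hg : ∀ z ∈ P.U, (P.objective x y z : EReal) = P.fmeObjective x z) : P.IsPAROPair x y := by
  refine ⟨isARO_of_greedy hM hx.1 hy hg, ?_⟩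
  rintro ⟨x', y', h', hle, z, hz, hlt⟩
  refine hx.2 ⟨x', h'.isRobustOptimal hM, fun w hw => ?_, z, hz, ?_⟩
  · rw [← hg w hw]
    exact (fmeObjective_le_objective hM h'.1 hw).trans (EReal.coe_le_coe_iff.2 (hle w hw))
  · rw [← hg z hz]
    exact (fmeObjective_le_objective hM h'.1 hz).trans_lt (EReal.coe_lt_coe_iff.2 hlt)

lemma IsPAROPair.isParetoRobustOptimal (hM : P.setM.Nonempty) (h : P.IsPAROPair x y) :
    IsParetoRobustOptimal P.XFME P.U P.fmeObjective x := by
  refine ⟨h.1.isRobustOptimal hM, ?_⟩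
  rintro ⟨x', hx', hle, z, hz, hlt⟩
  obtain ⟨y', hy', hg⟩ := exists_greedy hM hx'.1
  refine h.2 ⟨x', y', isARO_of_greedy hM hx' hy' hg, fun w hw => ?_, z, hz, ?_⟩
  · rw [← EReal.coe_le_coe_iff, hg w hw]
    exact (hle w hw).trans (fmeObjective_le_objective hM h.1.1 hw)
  · rw [← EReal.coe_lt_coe_iff, hg z hz]
    exact hlt.trans_le (fmeObjective_le_objective hM h.1.1 hz)

theorem isPARO_iff (hM : P.setM.Nonempty) :
    P.IsPARO x ↔ IsParetoRobustOptimal P.XFME P.U P.fmeObjective x := by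
  refine ⟨fun ⟨_, hy⟩ => hy.isParetoRobustOptimal hM, fun h => ?_⟩
  obtain ⟨y, hy, hg⟩ := exists_greedy hM h.1.1
  exact ⟨y, isPAROPair_of_greedy hM h hy hg⟩

/-- A Pareto optimal rule is greedy, as the greedy rule for the same `x` would dominate it
otherwise. -/
lemma IsPAROPair.greedy (hM : P.setM.Nonempty) (h : P.IsPAROPair x y) (hz : z ∈ P.U) :
    (P.objective x y z : EReal) = P.fmeObjective x z := by
  obtain ⟨y', hy', hg⟩ := exists_greedy hM h.1.1.mem_XFME
  refine le_antisymm ?_ (fmeObjective_le_objective hM h.1.1 hz)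
  by_contra! hlt
  refine h.2 ⟨x, y', isARO_of_greedy hM (h.1.isRobustOptimal hM) hy' hg, fun w hw => ?_, z, hz, ?_⟩
  · rw [← EReal.coe_le_coe_iff, hg w hw]
    exact fmeObjective_le_objective hM h.1.1 hw
  · rwa [← EReal.coe_lt_coe_iff, hg z hz]

/-! ### Affinity of `h_{S,T}` -/

lemma affineMap_sum_apply {V κ : Type*} [AddCommGroup V] [Module ℝ V] (s : Finset κ)
    (f : κ → V →ᵃ[ℝ] ℝ) (v : V) : (∑ p ∈ s, f p) v = ∑ p ∈ s, f p v := by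
  classical
  induction s using Finset.induction_on with
  | empty => simp
  | insert a s ha ih => simp [Finset.sum_insert ha, ih]

variable (P)

lemma exists_affineMap_hST_left (q : FMEBound (Fin (m + 1)) ny × FMEBound (Fin (m + 1)) ny)
    (z : Fin L → ℝ) : ∃ g : (Fin nx → ℝ) →ᵃ[ℝ] ℝ, ∀ x, P.hST q x z = g x := by
  let f (p : Fin m) : (Fin nx → ℝ) →ᵃ[ℝ] ℝ := AffineMap.const ℝ _ (P.r z p) -
    ((LinearMap.proj p).comp (P.A z).mulVecLin : (Fin nx → ℝ) →ₗ[ℝ] ℝ).toAffineMap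
  refine ⟨∑ p : Fin m, (q.1.α p.succ / (q.2.α 0 - q.1.α 0)) • f p -
    ∑ p : Fin m, (q.2.α p.succ / (q.2.α 0 - q.1.α 0)) • f p, fun x => ?_⟩
  simp [hST, phi, f, affineMap_sum_apply]

lemma exists_affineMap_hST_right (q : FMEBound (Fin (m + 1)) ny × FMEBound (Fin (m + 1)) ny)
    (x : Fin nx → ℝ) : ∃ g : (Fin L → ℝ) →ᵃ[ℝ] ℝ, ∀ z, P.hST q x z = g z := by
  let ev (p : Fin m) : Matrix (Fin m) (Fin nx) ℝ →ₗ[ℝ] ℝ :=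
    { toFun := fun A => A.mulVec x p
      map_add' := fun A A' => by rw [Matrix.add_mulVec, Pi.add_apply]
      map_smul' := fun t A => by rw [Matrix.smul_mulVec, Pi.smul_apply, RingHom.id_apply] }
  let f (p : Fin m) : (Fin L → ℝ) →ᵃ[ℝ] ℝ :=
    (LinearMap.proj p : (Fin m → ℝ) →ₗ[ℝ] ℝ).toAffineMap.comp P.r -
      (ev p).toAffineMap.comp P.A
  refine ⟨∑ p : Fin m, (q.1.α p.succ / (q.2.α 0 - q.1.α 0)) • f p -
    ∑ p : Fin m, (q.2.α p.succ / (q.2.α 0 - q.1.α 0)) • f p, fun z => ?_⟩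
  simp [hST, phi, f, ev, affineMap_sum_apply]

end AdaptiveProblem

theorem mainTheorem2 {L nx ny m : ℕ} (P : AdaptiveProblem L nx ny m)
    (hUconv : Convex ℝ P.U) (hUcomp : IsCompact P.U) (hUri : (intrinsicInterior ℝ P.U).Nonempty)
    (hfin : ∃ v : ℝ, P.optimalValue = (v : EReal)) :
    -- the second term of the static objective is a maximum of finitely many affine functions
    (P.setM.Finite ∧ P.setM.Nonempty ∧
      ∀ q ∈ P.setM,
        (∀ z, ∃ g : (Fin nx → ℝ) →ᵃ[ℝ] ℝ, ∀ x, P.hST q x z = g x) ∧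
        (∀ x, ∃ g : (Fin L → ℝ) →ᵃ[ℝ] ℝ, ∀ z, P.hST q x z = g z)) ∧
    -- PARO to the adaptive problem is the same as PRO to the static problem
    (∀ x, P.IsPARO x ↔ IsParetoRobustOptimal P.XFME P.U P.fmeObjective x) ∧
    -- every ARO decision rule is bounded below by the maximum, and attains it in every scenario
    -- that is a worst case for the static problem
    (∀ x y, P.IsARO x y → ∀ z ∈ P.U,
      (∀ q ∈ P.setM, P.hST q x z ≤ dotProduct P.d (y z)) ∧
      ((∀ z' ∈ P.U, P.fmeObjective x z' ≤ P.fmeObjective x z) →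
        IsGreatest ((fun q => P.hST q x z) '' P.setM) (dotProduct P.d (y z)))) ∧
    -- for a PARO `x`, an ARO decision rule attains it in every scenario iff the pair is PARO
    (∀ x, P.IsPARO x → ∀ y, P.IsARO x y →
      (P.IsPAROPair x y ↔
        ∀ z ∈ P.U,
          IsGreatest ((fun q => P.hST q x z) '' P.setM) (dotProduct P.d (y z)))) := by 
  have hM := AdaptiveProblem.setM_nonempty hfin
  refine ⟨⟨P.setM_finite, hM, fun q _ =>
    ⟨P.exists_affineMap_hST_left q, P.exists_affineMap_hST_right q⟩⟩,
    fun x => AdaptiveProblem.isPARO_iff hM, fun x y h z hz => ⟨h.1.hST_le hz, fun hmax => ?_⟩,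
    fun x hx y h => ⟨fun hxy z hz => ?_, fun hg => ?_⟩⟩
  · rw [← AdaptiveProblem.objective_eq_fmeObjective_iff hM]
    -- in a worst case `z` of the static problem, the worst-case value already caps the cost
    refine le_antisymm ?_ (AdaptiveProblem.fmeObjective_le_objective hM h.1 hz)
    calc (P.objective x y z : EReal) ≤ P.worstCase x y :=
          le_iSup₂ (f := fun z _ => (P.objective x y z : EReal)) z hz
      _ = ⨆ z ∈ P.U, P.fmeObjective x z := h.worstCase_eq hM
      _ ≤ P.fmeObjective x z := iSup₂_le hmax
  · exact (AdaptiveProblem.objective_eq_fmeObjective_iff hM).1 (hxy.greedy hM hz)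
  · exact AdaptiveProblem.isPAROPair_of_greedy hM ((AdaptiveProblem.isPARO_iff hM).1 hx) h.1
      fun z hz => (AdaptiveProblem.objective_eq_fmeObjective_iff hM).2 (hg z hz)
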